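/- Let $(M,h)$ be a smooth Riemannian surface with a spin structure, let $\Sigma M$ be its (complex rank two) spinor bundle with hermitian product $\langle\cdot,\cdot\rangle$, Clifford multiplication $X\cdot$ and spinor connection $\nabla$, and let $D=\sum_\alpha e_\alpha\cdot\nabla_{e_\alpha}$ be the Dirac operator, where $e_1,e_2$ denotes a positively oriented local orthonormal frame. Put $P_\pm=\tfrac12(1\pm i\,e_1\cdot e_2\cdot)$. Let $\lambda,\kappa\in\mathbb R$, $q\in\mathbb N$, and let $\psi=(\psi^1,\dots,\psi^q)$ be a smooth section of $\Sigma M\otimes\mathbb R^q$ that solves the Gross--Neveu equation $$D\psi^i=\lambda\psi^i+\kappa|\psi|^2\psi^i,\qquad i=1,\dots,q,\qquad |\psi|^2=\sum_{j=1}^q|\psi^j|^2 .$$ Let $(x,y)$ be local coordinates of $M$ with coordinate vector fields $\partial_x,\partial_y$, let $p$ be a point of their domain, and let $J_x,J_y$ be the $q\times q$ matrix-valued functions $J_x^{im}=\langle\psi^i,\partial_x\cdot\psi^m\rangle$, $J_y^{im}=\langle\psi^i,\partial_y\cdot\psi^m\rangle$. (1) If $h(\partial_x,\partial_y)=0$ at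 $p$ (for example, if the coordinates are isothermal) and if the indices $i,m$ are such that at $p$ $$\sum_{j=1}^q|P_-\psi^j|^2\,\langle P_-\psi^i,P_-\psi^m\rangle=\sum_{j=1}^q|P_+\psi^j|^2\,\langle P_+\psi^i,P_+\psi^m\rangle, \qquad(*)$$ then at $p$ $$\partial_xJ_y^{im}-\partial_yJ_x^{im}-\kappa\sum_{j=1}^q\bigl(J_x^{ij}J_y^{jm}-J_y^{ij}J_x^{jm}\bigr)=2\lambda\langle\psi^i,\partial_x\cdot\partial_y\cdot\psi^m\rangle .$$ (2) If $\lambda=0$ and $(*)$ holds at $p$ for all $i,m$, then at $p$, in arbitrary coordinates, $\partial_xJ_y-\partial_yJ_x-\kappa[J_x,J_y]=0$; in particular the connection $d+A$ with $A=-\kappa(J_x\,dx+J_y\,dy)$ has zero curvature at $p$: $\partial_xA_y-\partial_yA_x+[A_x,A_y]=0$. -/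

import Mathlib

open scoped Manifold ContDiff Bundle

noncomputable section

namespace GrossNeveu

/-- The plane on which surfaces are modelled. -/
abbrev Plane : Type := EuclideanSpace ℝ (Fin 2)

/-- The complex spinor module `ℂ²` of the Clifford algebra of the Euclidean plane. -/
abbrev Spinor : Type := Fin 2 → ℂ

/-- Clifford multiplication by the standard orthonormal basis of the plane. -/
def gam : Fin 2 → Matrix (Fin 2) (Fin 2) ℂ :=
  ![!![0, 1; -1, 0], !![0, Complex.I; Complex.I, 0]]

/-- The standard hermitian product on `ℂ²`, linear in the first argument. -/
def herm (φ η : Spinor) : ℂ := ∑ k, φ k * star (η k)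

/-- `|φ|²` for the standard hermitian product. -/
def normSq (φ : Spinor) : ℝ := ∑ k, Complex.normSq (φ k)

/-- The spin representation of `Spin(2) = {cos t + sin t e₁·e₂}`, identified with the unit circle
through `u = cos t + i sin t`, extended real-linearly to all of `ℂ`. -/
def spinRep : ℂ →L[ℝ] Spinor →L[ℝ] Spinor :=
  LinearMap.toContinuousLinearMap
    { toFun := fun u => LinearMap.toContinuousLinearMap
        { toFun := fun φ => u.re • φ + u.im • ((gam 0 * gam 1).mulVec φ)
          map_add' := by
            intro x y
            simp only [Matrix.mulVec_add, smul_add]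
            abel
          map_smul' := by
            intro c x
            simp only [Matrix.mulVec_smul, smul_add, RingHom.id_apply]
            rw [smul_comm c u.re, smul_comm c u.im] }
      map_add' := by
        intro u v
        ext φ : 1
        simp only [LinearMap.coe_toContinuousLinearMap', LinearMap.coe_mk, AddHom.coe_mk,
          add_apply, Complex.add_re, Complex.add_im, add_smul]
        abel
      map_smul' := by
        intro c u
        ext φ : 1
        simp only [LinearMap.coe_toContinuousLinearMap', LinearMap.coe_mk, AddHom.coe_mk,
          smul_apply, Complex.real_smul, Complex.re_ofReal_mul,
          Complex.im_ofReal_mul, RingHom.id_apply, smul_add, mul_smul] }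

theorem spinRep_apply (u : ℂ) (φ : Spinor) :
    spinRep u φ = u.re • φ + u.im • ((gam 0 * gam 1).mulVec φ) := rfl

theorem spinRep_one (φ : Spinor) : spinRep 1 φ = φ := by
  simp [spinRep_apply]

theorem spinRep_mul (u v : ℂ) (φ : Spinor) : spinRep (u * v) φ = spinRep u (spinRep v φ) := by
  have hsq : (gam 0 * gam 1) * (gam 0 * gam 1) = -1 := by
    ext i j
    fin_cases i <;> fin_cases j <;> simp [gam, Matrix.mul_apply, Fin.sum_univ_two]
  simp only [spinRep_apply, Matrix.mulVec_add, Matrix.mulVec_smul, Matrix.mulVec_mulVec, hsq,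
    Matrix.neg_mulVec, Matrix.one_mulVec, Complex.mul_re, Complex.mul_im]
  module

variable {M : Type*} [TopologicalSpace M] [ChartedSpace Plane M] [IsManifold 𝓘(ℝ, Plane) ∞ M]

/-- A smooth Riemannian metric on the surface `M`. -/
abbrev SurfaceMetric (M : Type*) [TopologicalSpace M] [ChartedSpace Plane M]
    [IsManifold 𝓘(ℝ, Plane) ∞ M] : Type _ :=
  Bundle.ContMDiffRiemannianMetric 𝓘(ℝ, Plane) ∞ Plane
    (fun p : M => TangentSpace 𝓘(ℝ, Plane) p)

/-- A spin structure on the Riemannian surface `(M, h)`: a cover of `M` by domains of smooth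
orthonormal frames whose changes of frame are rotations (so that they orient `M`), with a smooth
lift of these rotations through the double cover `Spin(2) → SO(2)`, `u ↦ u²`, that satisfies
the cocycle condition. -/
structure SpinStructure (h : SurfaceMetric M) (ι : Type*) where
  baseSet : ι → Set M
  isOpen_baseSet : ∀ a, IsOpen (baseSet a)
  indexAt : M → ι
  mem_baseSet_at : ∀ p, p ∈ baseSet (indexAt p)
  frame : ι → Fin 2 → (p : M) → TangentSpace 𝓘(ℝ, Plane) p
  contMDiffOn_frame : ∀ a k,
    ContMDiffOn 𝓘(ℝ, Plane) 𝓘(ℝ, Plane).tangent ∞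
      (fun p => (⟨p, frame a k p⟩ : TangentBundle 𝓘(ℝ, Plane) M)) (baseSet a)
  orthonormal : ∀ a, ∀ p ∈ baseSet a, ∀ k l,
    h.inner p (frame a k p) (frame a l p) = if k = l then 1 else 0
  lift : ι → ι → M → Circle
  contMDiffOn_lift : ∀ a b,
    ContMDiffOn 𝓘(ℝ, Plane) 𝓘(ℝ, ℂ) ∞ (fun p => (lift a b p : ℂ)) (baseSet a ∩ baseSet b)
  frame_change_zero : ∀ a b, ∀ p ∈ baseSet a ∩ baseSet b,
    frame b 0 p = ((lift a b p : ℂ) ^ 2).re • frame a 0 p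
      + ((lift a b p : ℂ) ^ 2).im • frame a 1 p
  frame_change_one : ∀ a b, ∀ p ∈ baseSet a ∩ baseSet b,
    frame b 1 p = (-((lift a b p : ℂ) ^ 2).im) • frame a 0 p
      + ((lift a b p : ℂ) ^ 2).re • frame a 1 p
  lift_comp : ∀ a b c, ∀ p ∈ baseSet a ∩ baseSet b ∩ baseSet c,
    lift a b p * lift b c p = lift a c p

namespace SpinStructure

variable {h : SurfaceMetric M} {ι : Type*} (S : SpinStructure h ι)

theorem lift_self (a : ι) (p : M) (hp : p ∈ S.baseSet a) : S.lift a a p = 1 := by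
  have := S.lift_comp a a a p ⟨⟨hp, hp⟩, hp⟩
  simpa using this

/-- The spinor bundle `ΣM`, associated to the spin structure by the spin representation. The
components `φ_a`, `φ_b` of a spinor in the trivializations `a`, `b` satisfy
`φ_b = spinRep (lift b a) φ_a`. -/
def spinorBundle : VectorBundleCore ℝ M Spinor ι where
  baseSet := S.baseSet
  isOpen_baseSet := S.isOpen_baseSet
  indexAt := S.indexAt
  mem_baseSet_at := S.mem_baseSet_at
  coordChange a b p := spinRep (S.lift b a p : ℂ)
  coordChange_self a p hp v := by
    rw [S.lift_self a p hp, Circle.coe_one, spinRep_one]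
  continuousOn_coordChange a b := by
    refine spinRep.continuous.comp_continuousOn ?_
    rw [Set.inter_comm]
    exact (S.contMDiffOn_lift b a).continuousOn
  coordChange_comp a b c p hp v := by
    rw [← spinRep_mul, ← Circle.coe_mul, S.lift_comp c b a p ⟨⟨hp.2, hp.1.2⟩, hp.1.1⟩]

instance : S.spinorBundle.IsContMDiff 𝓘(ℝ, Plane) ∞ where
  contMDiffOn_coordChange a b := by
    have h1 := S.contMDiffOn_lift b a
    rw [Set.inter_comm] at h1
    exact spinRep.contMDiff.comp_contMDiffOn h1

/-- Smooth sections of the spinor bundle, that is `Γ(ΣM)`. -/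
abbrev SpinorField : Type _ :=
  ContMDiffSection 𝓘(ℝ, Plane) Spinor ∞ S.spinorBundle.Fiber

variable {S}

/-- The `ℂ²`-valued function that represents a spinor field in the trivialization `a`. -/
def comp (a : ι) (ψ : S.SpinorField) (p : M) : Spinor :=
  (S.spinorBundle.localTriv a ⟨p, ψ p⟩).2

/-- The value at `p` of a spinor field; the fibre of `ΣM` over `p` is identified with `ℂ²` by the
preferred trivialization at `p`. -/
def val (ψ : S.SpinorField) (p : M) : Spinor := comp (S.indexAt p) ψ p

variable (S)

/-- Clifford multiplication `X · φ` of a spinor at `p` by a tangent vector at `p`. -/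
def cliff (p : M) (X : TangentSpace 𝓘(ℝ, Plane) p) (φ : Spinor) : Spinor :=
  ∑ k, h.inner p X (S.frame (S.indexAt p) k p) • (gam k).mulVec φ

/-- The Levi-Civita connection form `X ↦ h(∇_X e₁, e₂)` of the orthonormal frame `e₁, e₂` with
index `a`. As `∇` is metric and torsion-free, `[e₁, e₂] = ∇_{e₁} e₂ - ∇_{e₂} e₁ =
-h(∇_{e₁} e₁, e₂) e₁ - h(∇_{e₂} e₁, e₂) e₂`, so that `h(∇_X e₁, e₂) = -h([e₁, e₂], X)`. -/
def connForm (a : ι) (p : M) (X : TangentSpace 𝓘(ℝ, Plane) p) : ℝ :=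
  - h.inner p (VectorField.mlieBracket 𝓘(ℝ, Plane) (S.frame a 0) (S.frame a 1) p) X

variable {S}

/-- The spinor connection `∇_X ψ = X(ψ) + ½ h(∇_X e₁, e₂) e₁ · e₂ · ψ`. -/
def nabla (ψ : S.SpinorField) (p : M) (X : TangentSpace 𝓘(ℝ, Plane) p) : Spinor :=
  (show Spinor from mfderiv 𝓘(ℝ, Plane) 𝓘(ℝ, Spinor) (comp (S.indexAt p) ψ) p X)
    + (S.connForm (S.indexAt p) p X / 2) • (gam 0 * gam 1).mulVec (val ψ p)

/-- The Dirac operator `∑ₖ eₖ · ∇_{eₖ} ψ`. -/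
def dirac (ψ : S.SpinorField) (p : M) : Spinor :=
  ∑ k, S.cliff p (S.frame (S.indexAt p) k p) (nabla ψ p (S.frame (S.indexAt p) k p))

variable (S)

/-- The complex volume element `i e₁ · e₂` acting on spinors at `p`. -/
def volumeElement (p : M) (φ : Spinor) : Spinor :=
  Complex.I • S.cliff p (S.frame (S.indexAt p) 0 p) (S.cliff p (S.frame (S.indexAt p) 1 p) φ)

/-- The projector `P₊ = ½ (1 + i e₁ · e₂)`. -/
def projPlus (p : M) (φ : Spinor) : Spinor := (1 / 2 : ℂ) • (φ + S.volumeElement p φ)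

/-- The projector `P₋ = ½ (1 - i e₁ · e₂)`. -/
def projMinus (p : M) (φ : Spinor) : Spinor := (1 / 2 : ℂ) • (φ - S.volumeElement p φ)

variable {S}

/-- `|ψ|² = ∑ⱼ |ψʲ|²` for a section `ψ = (ψ¹, …, ψ^q)` of `ΣM ⊗ ℝ^q`. -/
def totalNormSq {q : ℕ} (ψ : Fin q → S.SpinorField) (p : M) : ℝ :=
  ∑ j, normSq (val (ψ j) p)

/-- The Gross-Neveu equation `D ψⁱ = lam ψⁱ + κ |ψ|² ψⁱ` on `M`. -/
def IsGrossNeveuSolution {q : ℕ} (lam κ : ℝ) (ψ : Fin q → S.SpinorField) : Prop :=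
  ∀ i p, dirac (ψ i) p = lam • val (ψ i) p + (κ * totalNormSq ψ p) • val (ψ i) p

/-- The condition `|P₋ψʲ|² ⟨P₋ψⁱ, P₋ψᵐ⟩ = |P₊ψʲ|² ⟨P₊ψⁱ, P₊ψᵐ⟩` at the point `p`, with summation
over `j`. -/
def MajoranaAt {q : ℕ} (ψ : Fin q → S.SpinorField) (i m : Fin q) (p : M) : Prop :=
  ((∑ j, normSq (S.projMinus p (val (ψ j) p)) : ℝ) : ℂ)
      * herm (S.projMinus p (val (ψ i) p)) (S.projMinus p (val (ψ m) p))
    = ((∑ j, normSq (S.projPlus p (val (ψ j) p)) : ℝ) : ℂ)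
      * herm (S.projPlus p (val (ψ i) p)) (S.projPlus p (val (ψ m) p))

end SpinStructure

/-- The coordinate vector field `∂ₖ` of a chart `c` of `M`. -/
def coordField (c : OpenPartialHomeomorph M Plane) (k : Fin 2) (p : M) :
    TangentSpace 𝓘(ℝ, Plane) p :=
  VectorField.mpullback 𝓘(ℝ, Plane) 𝓘(ℝ, Plane) c
    (fun _ => (EuclideanSpace.single k 1 : Plane)) p

/-- The partial derivative `∂ₖ f` of a function on `M` in the chart `c`. -/
def partialDeriv (c : OpenPartialHomeomorph M Plane) (k : Fin 2) (f : M → ℂ) (p : M) : ℂ :=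
  fderiv ℝ (f ∘ c.symm) (c p) (EuclideanSpace.single k 1)

/-- The entrywise partial derivative of a matrix-valued function. -/
def matrixDeriv {q : ℕ} (c : OpenPartialHomeomorph M Plane) (k : Fin 2)
    (A : M → Matrix (Fin q) (Fin q) ℂ) (p : M) : Matrix (Fin q) (Fin q) ℂ :=
  Matrix.of fun i m => partialDeriv c k (fun r => A r i m) p

/-- The curvature `∂ₓA_y - ∂_yAₓ + [Aₓ, A_y]` in the chart `c` of the connection `d + A`, where
`A 0` and `A 1` are the components of the matrix-valued one-form in the chart. -/
def curvature {q : ℕ} (c : OpenPartialHomeomorph M Plane)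
    (A : Fin 2 → M → Matrix (Fin q) (Fin q) ℂ) (p : M) : Matrix (Fin q) (Fin q) ℂ :=
  matrixDeriv c 0 (A 1) p - matrixDeriv c 1 (A 0) p + (A 0 p * A 1 p - A 1 p * A 0 p)

/-- The component in direction `k`, in the chart `c`, of the Noether current
`Jⁱᵐ(X) = ⟨ψⁱ, X · ψᵐ⟩`. -/
def current {h : SurfaceMetric M} {ι : Type*} {S : SpinStructure h ι} {q : ℕ}
    (ψ : Fin q → S.SpinorField) (c : OpenPartialHomeomorph M Plane) (k : Fin 2) (p : M) :
    Matrix (Fin q) (Fin q) ℂ :=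
  Matrix.of fun i m =>
    herm (SpinStructure.val (ψ i) p) (S.cliff p (coordField c k p) (SpinStructure.val (ψ m) p))

end GrossNeveu

end

/-! Near `p` expand everything in one orthonormal frame `e₁, e₂`. The current becomes a one-form
whose components are `⟨ψⁱ, e_l · ψᵐ⟩`, and both its exterior derivative and the commutator of its
coordinate components are the determinant `coordDet` of the coordinate frame times a frame quantity.

For the derivative, Leibniz differentiates the spinors and the coframe. The coframe part is Cartan's
structure equation (`deriv_coordCoeff`) and supplies exactly the connection terms hidden in the
Dirac operator. Pairing the two Dirac equations with `e₁ · e₂ ·` (`herm_exteriorDeriv`) gives `2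
(lam + κ|ψ|²) ⟨ψⁱ, e₁ · e₂ · ψᵐ⟩` (`exteriorDeriv_current`).

For the commutator, `P₋` and `P₊` are the two coordinate projections of `ℂ²`. Write `a`, `b` for the
sums over `j` of `|P₋ψʲ|²`, `|P₊ψʲ|²`, and `u`, `v` for `⟨P₋ψⁱ, P₋ψᵐ⟩`, `⟨P₊ψⁱ, P₊ψᵐ⟩`. The frame
commutator is `-2i (b u - a v)`, whereas `2|ψ|² ⟨ψⁱ, e₁ · e₂ · ψᵐ⟩ = -2i (a + b)(u - v)`. They agree
exactly when `a u = b v`, which is the hypothesis (*). Hence the terms in `κ` cancel and only the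
one in `lam` survives. -/

noncomputable section

namespace GrossNeveu

/-! ### Spinor algebra in `ℂ²` -/

section Algebra

/-- The real-bilinear map `(φ, η) ↦ ⟨φ, A η⟩`. -/
def hermMulVec (A : Matrix (Fin 2) (Fin 2) ℂ) : Spinor →L[ℝ] Spinor →L[ℝ] ℂ :=
  LinearMap.toContinuousBilinearMap <| LinearMap.mk₂ ℝ (fun φ η => herm φ (A.mulVec η))
    (by intro φ φ' η; simp only [herm, Fin.sum_univ_two, Pi.add_apply]; ring)
    (by intro s φ η; simp only [herm, Fin.sum_univ_two, Pi.smul_apply, Complex.real_smul]; ring)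
    (by
      intro φ η η'
      simp only [herm, Fin.sum_univ_two, Matrix.mulVec_add, Pi.add_apply, star_add]
      ring)
    (by
      intro s φ η
      simp only [herm, Fin.sum_univ_two, Matrix.mulVec_smul, Pi.smul_apply, Complex.real_smul, star_mul,
        Complex.star_def, Complex.conj_ofReal]
      ring)

theorem hermMulVec_apply (A : Matrix (Fin 2) (Fin 2) ℂ) (φ η : Spinor) :
    hermMulVec A φ η = herm φ (A.mulVec η) := rfl

theorem herm_real_smul (s : ℝ) (φ η : Spinor) : herm φ (s • η) = s * herm φ η := by
  simp only [herm, Fin.sum_univ_two, Pi.smul_apply, Complex.real_smul, star_mul, Complex.star_def,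
    Complex.conj_ofReal]
  ring

/-- Leibniz rule for a current written in a frame. Bilinearity is over `ℝ` because the hermitian
product is antilinear in its second argument. -/
theorem fderiv_sum_smul_bilinear {E F G H κ : Type*} [Fintype κ] [NormedAddCommGroup E]
    [NormedSpace ℝ E] [NormedAddCommGroup F] [NormedSpace ℝ F] [NormedAddCommGroup G]
    [NormedSpace ℝ G] [NormedAddCommGroup H] [NormedSpace ℝ H] {B : κ → F →L[ℝ] G →L[ℝ] H}
    {s : κ → E → ℝ} {φ : E → F} {η : E → G} {x : E} (hs : ∀ l, DifferentiableAt ℝ (s l) x)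
    (hφ : DifferentiableAt ℝ φ x) (hη : DifferentiableAt ℝ η x) (v : E) :
    fderiv ℝ (fun y => ∑ l, s l y • B l (φ y) (η y)) x v
      = ∑ l, (s l x • (B l (fderiv ℝ φ x v) (η x) + B l (φ x) (fderiv ℝ η x v))
        + fderiv ℝ (s l) x v • B l (φ x) (η x)) := by
  have key := HasFDerivAt.fun_sum (u := Finset.univ) fun l _ =>
    (hs l).hasFDerivAt.fun_smul
      ((B l).hasFDerivAt_of_bilinear hφ.hasFDerivAt hη.hasFDerivAt)
  rw [key.fderiv]
  simp [add_comm]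

theorem gam_mulVec_zero (φ : Spinor) : (gam 0).mulVec φ = ![φ 1, -φ 0] := by
  ext k; fin_cases k <;> simp [gam, Matrix.mulVec, dotProduct]

theorem gam_mulVec_one (φ : Spinor) :
    (gam 1).mulVec φ = ![Complex.I * φ 1, Complex.I * φ 0] := by
  ext k; fin_cases k <;> simp [gam, Matrix.mulVec, dotProduct]

theorem gam_mul_gam_mulVec (φ : Spinor) :
    (gam 0 * gam 1).mulVec φ = ![Complex.I * φ 0, -(Complex.I * φ 1)] := by
  rw [← Matrix.mulVec_mulVec, gam_mulVec_one, gam_mulVec_zero]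
  simp

/-- If `X k` and `Y k` are the frame derivatives of two solutions `x` and `y` of
`D ψ = F ψ`, then the terms that form the exterior derivative of the current `⟨x, · y⟩` add up to
`2 F ⟨x, e₁ · e₂ · y⟩`. -/
theorem herm_exteriorDeriv {x y : Spinor} {X Y : Fin 2 → Spinor} {w : Fin 2 → ℝ} {F : ℝ}
    (hx : ∑ k, (gam k).mulVec (X k + (w k / 2) • (gam 0 * gam 1).mulVec x) = F • x)
    (hy : ∑ k, (gam k).mulVec (Y k + (w k / 2) • (gam 0 * gam 1).mulVec y) = F • y) :
    w 0 * herm x ((gam 0).mulVec y) + w 1 * herm x ((gam 1).mulVec y)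
      + (herm (X 0) ((gam 1).mulVec y) + herm x ((gam 1).mulVec (Y 0)))
      - (herm (X 1) ((gam 0).mulVec y) + herm x ((gam 0).mulVec (Y 1)))
      = 2 * F * herm x ((gam 0 * gam 1).mulVec y) := by
  have hx0 := congrFun hx 0
  have hx1 := congrFun hx 1
  have hy0 := congrArg (starRingEnd ℂ) (congrFun hy 0)
  have hy1 := congrArg (starRingEnd ℂ) (congrFun hy 1)
  simp only [Fin.sum_univ_two, gam_mulVec_zero, gam_mulVec_one, gam_mul_gam_mulVec, herm] at *
  simp [Complex.conj_ofNat] at *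
  -- These coefficients form `⟨Dx, e₁ · e₂ · y⟩ + ⟨x, e₁ · e₂ · Dy⟩`. Since each `e_k ·` is unitary
  -- with square `-1` and the two anticommute, the derivative terms lose one Clifford factor, and
  -- the two halves `w k / 2` add up to `w k`.
  linear_combination (norm := (ring_nf; simp only [Complex.I_sq, Complex.I_pow_three]; ring))
    (-Complex.I * (starRingEnd ℂ) (y 0)) * hx0 + (Complex.I * (starRingEnd ℂ) (y 1)) * hx1
    + (-Complex.I * x 0) * hy0 + (Complex.I * x 1) * hy1

/-- Clifford multiplication by a vector swaps the two components, so passing through `z` links `x 0`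
to `y 0` via `z 1`, and `x 1` to `y 1` via `z 0`. The mixed terms are the same in both products and
cancel. -/
theorem herm_gam_commutator (x y z : Spinor) :
    herm x ((gam 0).mulVec z) * herm z ((gam 1).mulVec y)
      - herm x ((gam 1).mulVec z) * herm z ((gam 0).mulVec y)
      = -2 * Complex.I * (Complex.normSq (z 1) * (x 0 * star (y 0))
        - Complex.normSq (z 0) * (x 1 * star (y 1))) := by
  simp only [Fin.sum_univ_two, gam_mulVec_zero, gam_mulVec_one, herm, ← Complex.mul_conj]
  simp
  ring

theorem herm_gam_mul_gam (x y : Spinor) :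
    herm x ((gam 0 * gam 1).mulVec y) = -Complex.I * (x 0 * star (y 0) - x 1 * star (y 1)) := by
  simp only [Fin.sum_univ_two, gam_mul_gam_mulVec, herm]
  simp
  ring

end Algebra

/-! ### Coordinate vector fields and derivatives in a chart -/

section Coordinates

variable {M : Type*} [TopologicalSpace M] [ChartedSpace Plane M]

theorem two_le_infty : (2 : WithTop ℕ∞) ≤ ∞ :=
  WithTop.coe_le_coe.2 (le_top : (2 : ℕ∞) ≤ ⊤)

/-- The constant vector field `v` on the plane. -/
def constField (v : Plane) (x : Plane) : TangentSpace 𝓘(ℝ, Plane) x := v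

theorem mdifferentiableAt_constField (v x : Plane) :
    MDifferentiableAt 𝓘(ℝ, Plane) 𝓘(ℝ, Plane).tangent
      (fun r => (⟨r, constField v r⟩ : TangentBundle 𝓘(ℝ, Plane) Plane)) x :=
  (contMDiffAt_vectorSpace_iff_contDiffAt (n := 1) (V := constField v) |>.2
    (contDiffAt_const (c := v))).mdifferentiableAt one_ne_zero

theorem mlieBracket_constField (v w x : Plane) :
    VectorField.mlieBracket 𝓘(ℝ, Plane) (constField v) (constField w) x = 0 := by
  rw [← VectorField.mlieBracketWithin_univ, VectorField.mlieBracketWithin_eq_lieBracketWithin]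
  change fderivWithin ℝ (fun _ : Plane => w) Set.univ x v
    - fderivWithin ℝ (fun _ : Plane => v) Set.univ x w = 0
  simp

section Chart

variable {c : OpenPartialHomeomorph M Plane} {p : M}

theorem mdifferentiable_of_mem_maximalAtlas
    (hc : c ∈ IsManifold.maximalAtlas 𝓘(ℝ, Plane) ∞ M) :
    c.MDifferentiable 𝓘(ℝ, Plane) 𝓘(ℝ, Plane) :=
  ⟨(contMDiffOn_of_mem_maximalAtlas hc).mdifferentiableOn (by simp),
    (contMDiffOn_symm_of_mem_maximalAtlas hc).mdifferentiableOn (by simp)⟩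

variable {F : Type*} [NormedAddCommGroup F] [NormedSpace ℝ F]

theorem differentiableAt_comp_chart_symm (hc : c ∈ IsManifold.maximalAtlas 𝓘(ℝ, Plane) ∞ M)
    (hp : p ∈ c.source) {f : M → F} (hf : MDifferentiableAt 𝓘(ℝ, Plane) 𝓘(ℝ, F) f p) :
    DifferentiableAt ℝ (f ∘ c.symm) (c p) := by
  rw [← mdifferentiableAt_iff_differentiableAt]
  refine MDifferentiableAt.comp (I' := 𝓘(ℝ, Plane)) (c p) ?_
    ((mdifferentiable_of_mem_maximalAtlas hc).mdifferentiableAt_symm (c.map_source hp))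
  rwa [c.left_inv hp]

theorem isInvertible_mfderiv_chart (hc : c ∈ IsManifold.maximalAtlas 𝓘(ℝ, Plane) ∞ M)
    (hp : p ∈ c.source) : (mfderiv 𝓘(ℝ, Plane) 𝓘(ℝ, Plane) c p).IsInvertible :=
  ⟨(mdifferentiable_of_mem_maximalAtlas hc).mfderiv hp, rfl⟩

theorem mfderiv_chart_coordField (hc : c ∈ IsManifold.maximalAtlas 𝓘(ℝ, Plane) ∞ M)
    (hp : p ∈ c.source) (k : Fin 2) :
    mfderiv 𝓘(ℝ, Plane) 𝓘(ℝ, Plane) c p (coordField c k p)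
      = (EuclideanSpace.single k 1 : Plane) := by
  obtain ⟨e, he⟩ := isInvertible_mfderiv_chart hc hp
  have h : coordField c k p = e.symm (EuclideanSpace.single k 1 : Plane) := by
    change (mfderiv 𝓘(ℝ, Plane) 𝓘(ℝ, Plane) c p).inverse _ = _
    rw [← he, ContinuousLinearMap.inverse_equiv]
    rfl
  rw [h, ← he]
  exact e.apply_symm_apply _

theorem fderiv_comp_chart_symm (hc : c ∈ IsManifold.maximalAtlas 𝓘(ℝ, Plane) ∞ M)
    (hp : p ∈ c.source) {f : M → F} (hf : MDifferentiableAt 𝓘(ℝ, Plane) 𝓘(ℝ, F) f p) (k : Fin 2) :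
    fderiv ℝ (f ∘ c.symm) (c p) (EuclideanSpace.single k 1)
      = mvfderiv 𝓘(ℝ, Plane) f p (coordField c k p) := by
  change _ = mfderiv 𝓘(ℝ, Plane) 𝓘(ℝ, F) f p (coordField c k p)
  have hg := (differentiableAt_comp_chart_symm hc hp hf).mdifferentiableAt
  have hcp := (mdifferentiable_of_mem_maximalAtlas hc).mdifferentiableAt hp
  have heq : (f ∘ c.symm) ∘ c =ᶠ[nhds p] f := by
    filter_upwards [c.open_source.mem_nhds hp] with r hr
    simp [c.left_inv hr]
  rw [← heq.mfderiv_eq, mfderiv_comp p hg hcp, mfderiv_eq_fderiv]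
  change _ = fderiv ℝ (f ∘ c.symm) (c p)
    (mfderiv 𝓘(ℝ, Plane) 𝓘(ℝ, Plane) c p (coordField c k p))
  rw [mfderiv_chart_coordField hc hp]

variable [IsManifold 𝓘(ℝ, Plane) ∞ M]

theorem mdifferentiableAt_coordField (hc : c ∈ IsManifold.maximalAtlas 𝓘(ℝ, Plane) ∞ M)
    (hp : p ∈ c.source) (k : Fin 2) :
    MDifferentiableAt 𝓘(ℝ, Plane) 𝓘(ℝ, Plane).tangent
      (fun r => (⟨r, coordField c k r⟩ : TangentBundle 𝓘(ℝ, Plane) M)) p := by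
  have : IsManifold 𝓘(ℝ, Plane) 2 M := .of_le two_le_infty
  exact MDifferentiableAt.mpullback_vectorField (n := 2) (mdifferentiableAt_constField _ _)
    ((contMDiffAt_of_mem_maximalAtlas hc hp).of_le two_le_infty)
    (isInvertible_mfderiv_chart hc hp) le_rfl

/-- Coordinate vector fields commute. -/
theorem mlieBracket_coordField (hc : c ∈ IsManifold.maximalAtlas 𝓘(ℝ, Plane) ∞ M)
    (hp : p ∈ c.source) (k l : Fin 2) :
    VectorField.mlieBracket 𝓘(ℝ, Plane) (coordField c k) (coordField c l) p = 0 := by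
  have h2 : IsManifold 𝓘(ℝ, Plane) 2 M := .of_le two_le_infty
  have : IsManifold 𝓘(ℝ, Plane) (minSmoothness ℝ 2) M := by simpa using h2
  -- The bracket is natural under pullback, and constant fields on the plane commute.
  refine (VectorField.mpullback_mlieBracket (n := ∞) (mdifferentiableAt_constField _ (c p))
    (mdifferentiableAt_constField _ (c p))
    (contMDiffAt_of_mem_maximalAtlas hc hp) (by simpa using two_le_infty)).symm.trans ?_
  rw [VectorField.mpullback_apply, mlieBracket_constField]
  exact map_zero _

end Chart

end Coordinates

/-! ### Orthonormal frames and Lie brackets -/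

section Frames

variable {M : Type*} [TopologicalSpace M] [ChartedSpace Plane M] [IsManifold 𝓘(ℝ, Plane) ∞ M]

theorem SurfaceMetric.mdifferentiableAt_inner (h : SurfaceMetric M)
    {V W : (p : M) → TangentSpace 𝓘(ℝ, Plane) p} {p : M}
    (hV : MDifferentiableAt 𝓘(ℝ, Plane) 𝓘(ℝ, Plane).tangent
      (fun r => (⟨r, V r⟩ : TangentBundle 𝓘(ℝ, Plane) M)) p)
    (hW : MDifferentiableAt 𝓘(ℝ, Plane) 𝓘(ℝ, Plane).tangent
      (fun r => (⟨r, W r⟩ : TangentBundle 𝓘(ℝ, Plane) M)) p) :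
    MDifferentiableAt 𝓘(ℝ, Plane) 𝓘(ℝ, ℝ) (fun r => h.inner r (V r) (W r)) p := by
  have : MDifferentiableAt 𝓘(ℝ, Plane) (𝓘(ℝ, Plane).prod 𝓘(ℝ))
      (fun m => Bundle.TotalSpace.mk' ℝ (E := Bundle.Trivial M ℝ) m (h.inner m (V m) (W m))) p := by
    apply MDifferentiableAt.clm_bundle_apply₂ (F₁ := Plane) (F₂ := Plane)
    · exact (h.contMDiff p).mdifferentiableAt (by simp)
    · exact hV
    · exact hW
  simpa using (mdifferentiableAt_totalSpace ..).1 this |>.2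

namespace SpinStructure

variable {h : SurfaceMetric M} {ι : Type*} (S : SpinStructure h ι)

theorem mdifferentiableAt_frame {a : ι} {p : M} (hp : p ∈ S.baseSet a) (k : Fin 2) :
    MDifferentiableAt 𝓘(ℝ, Plane) 𝓘(ℝ, Plane).tangent
      (fun r => (⟨r, S.frame a k r⟩ : TangentBundle 𝓘(ℝ, Plane) M)) p :=
  ((S.contMDiffOn_frame a k).contMDiffAt ((S.isOpen_baseSet a).mem_nhds hp)).mdifferentiableAt
    (by simp)

theorem eq_sum_inner_smul_frame {a : ι} {p : M} (hp : p ∈ S.baseSet a)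
    (X : TangentSpace 𝓘(ℝ, Plane) p) :
    X = h.inner p X (S.frame a 0 p) • S.frame a 0 p
      + h.inner p X (S.frame a 1 p) • S.frame a 1 p := by
  have ho := S.orthonormal a p hp
  have hli : LinearIndependent ℝ (fun k => S.frame a k p) := by
    rw [Fintype.linearIndependent_iff]
    intro g hg k
    have := congrArg (fun v => h.inner p v (S.frame a k p)) hg
    fin_cases k <;> simpa [Fin.sum_univ_two, ho] using this
  have hfin : Module.finrank ℝ (TangentSpace 𝓘(ℝ, Plane) p) = 2 := by
    change Module.finrank ℝ Plane = 2
    simp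
  have hsp := hli.span_eq_top_of_card_eq_finrank (by simp [hfin])
  have hX : X ∈ Submodule.span ℝ (Set.range fun k => S.frame a k p) := hsp ▸ Submodule.mem_top
  obtain ⟨g, rfl⟩ := (Submodule.mem_span_range_iff_exists_fun ℝ).1 hX
  simp [Fin.sum_univ_two, ho]

end SpinStructure

open VectorField in
/-- The Lie bracket of two linear combinations of `V` and `W` with variable coefficients. -/
theorem mlieBracket_combination {p : M}
    {X Y V W : (p : M) → TangentSpace 𝓘(ℝ, Plane) p} {f g : Fin 2 → M → ℝ}
    (hV : MDifferentiableAt 𝓘(ℝ, Plane) 𝓘(ℝ, Plane).tangent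
      (fun r => (⟨r, V r⟩ : TangentBundle 𝓘(ℝ, Plane) M)) p)
    (hW : MDifferentiableAt 𝓘(ℝ, Plane) 𝓘(ℝ, Plane).tangent
      (fun r => (⟨r, W r⟩ : TangentBundle 𝓘(ℝ, Plane) M)) p)
    (hf : ∀ k, MDifferentiableAt 𝓘(ℝ, Plane) 𝓘(ℝ, ℝ) (f k) p)
    (hg : ∀ k, MDifferentiableAt 𝓘(ℝ, Plane) 𝓘(ℝ, ℝ) (g k) p)
    (hX : X =ᶠ[nhds p] f 0 • V + f 1 • W) (hY : Y =ᶠ[nhds p] g 0 • V + g 1 • W) :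
    mlieBracket 𝓘(ℝ, Plane) X Y p
      = (mvfderiv 𝓘(ℝ, Plane) (g 0) p (X p)
          - mvfderiv 𝓘(ℝ, Plane) (f 0) p (Y p)) • V p
        + (mvfderiv 𝓘(ℝ, Plane) (g 1) p (X p)
          - mvfderiv 𝓘(ℝ, Plane) (f 1) p (Y p)) • W p
        + (f 0 p * g 1 p - f 1 p * g 0 p) • mlieBracket 𝓘(ℝ, Plane) V W p := by
  have : IsManifold 𝓘(ℝ, Plane) 2 M := .of_le two_le_infty
  have hfV := (hf 0).smul_section hV
  have hfW := (hf 1).smul_section hW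
  have hgV := (hg 0).smul_section hV
  have hgW := (hg 1).smul_section hW
  rw [hX.mlieBracket_vectorField_eq hY, mlieBracket_add_left hfV hfW,
    mlieBracket_smul_left (hf 0) hV, mlieBracket_smul_left (hf 1) hW,
    mlieBracket_add_right hgV hgW, mlieBracket_add_right hgV hgW,
    mlieBracket_smul_right (hg 0) hV, mlieBracket_smul_right (hg 1) hW,
    mlieBracket_smul_right (hg 0) hV, mlieBracket_smul_right (hg 1) hW,
    hX.self_of_nhds, hY.self_of_nhds, mlieBracket_swap_apply (V := W) (W := V)]
  simp only [Pi.add_apply, Pi.smul_apply', map_add, map_smul, mlieBracket_self, Pi.zero_apply,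
    smul_eq_mul]
  module

end Frames

/-! ### The coframe, and spinors in a fixed trivialization -/

section Coframe

variable {M : Type*} [TopologicalSpace M] [ChartedSpace Plane M] [IsManifold 𝓘(ℝ, Plane) ∞ M]

namespace SpinStructure

variable {h : SurfaceMetric M} {ι : Type*} (S : SpinStructure h ι)

/-- The coefficient of `e_l` in the expansion of `∂ₖ` in the frame with index `a`. -/
def coordCoeff (a : ι) (c : OpenPartialHomeomorph M Plane) (k l : Fin 2) (p : M) : ℝ :=
  h.inner p (coordField c k p) (S.frame a l p)

variable {c : OpenPartialHomeomorph M Plane} {p : M} {a : ι}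

theorem mdifferentiableAt_coordCoeff (hc : c ∈ IsManifold.maximalAtlas 𝓘(ℝ, Plane) ∞ M)
    (hp : p ∈ c.source) (ha : p ∈ S.baseSet a) (k l : Fin 2) :
    MDifferentiableAt 𝓘(ℝ, Plane) 𝓘(ℝ, ℝ) (S.coordCoeff a c k l) p :=
  SurfaceMetric.mdifferentiableAt_inner h (mdifferentiableAt_coordField hc hp k)
    (S.mdifferentiableAt_frame ha l)

theorem coordField_eq (ha : p ∈ S.baseSet a) (k : Fin 2) :
    coordField c k p = S.coordCoeff a c k 0 p • S.frame a 0 p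
      + S.coordCoeff a c k 1 p • S.frame a 1 p :=
  S.eq_sum_inner_smul_frame ha _

theorem inner_coordField (ha : p ∈ S.baseSet a) (k l : Fin 2) :
    h.inner p (coordField c k p) (coordField c l p)
      = S.coordCoeff a c k 0 p * S.coordCoeff a c l 0 p
        + S.coordCoeff a c k 1 p * S.coordCoeff a c l 1 p := by
  rw [S.coordField_eq ha l, map_add, map_smul, map_smul, smul_eq_mul, smul_eq_mul]
  simp only [coordCoeff]
  ring

/-- Cartan's first structure equation for the coframe dual to the frame with index `a`. -/
theorem deriv_coordCoeff (hc : c ∈ IsManifold.maximalAtlas 𝓘(ℝ, Plane) ∞ M)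
    (hp : p ∈ c.source) (ha : p ∈ S.baseSet a) (l : Fin 2) :
    mvfderiv 𝓘(ℝ, Plane) (S.coordCoeff a c 1 l) p (coordField c 0 p)
        - mvfderiv 𝓘(ℝ, Plane) (S.coordCoeff a c 0 l) p (coordField c 1 p)
      = (S.coordCoeff a c 0 0 p * S.coordCoeff a c 1 1 p
          - S.coordCoeff a c 0 1 p * S.coordCoeff a c 1 0 p)
        * S.connForm a p (S.frame a l p) := by
  have hev (k : Fin 2) : coordField c k =ᶠ[nhds p]
      S.coordCoeff a c k 0 • S.frame a 0 + S.coordCoeff a c k 1 • S.frame a 1 := by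
    filter_upwards [(S.isOpen_baseSet a).mem_nhds ha] with r hr
    exact S.coordField_eq hr k
  have key := mlieBracket_combination (S.mdifferentiableAt_frame ha 0)
    (S.mdifferentiableAt_frame ha 1) (S.mdifferentiableAt_coordCoeff hc hp ha 0)
    (S.mdifferentiableAt_coordCoeff hc hp ha 1) (hev 0) (hev 1)
  -- The expansion of `[∂ₓ, ∂_y] = 0` in the frame is paired with `e_l`; the bracket `[e₁, e₂]` then
  -- contributes minus the connection form on `e_l`.
  rw [mlieBracket_coordField hc hp] at key
  have key := congrArg (fun v => h.inner p v (S.frame a l p)) key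
  have ho := S.orthonormal a p ha
  fin_cases l <;>
  · simp [ho] at key
    simp [connForm]
    linarith

variable {S}

theorem comp_eq (a : ι) (ψ : S.SpinorField) (p : M) :
    comp a ψ p = spinRep (S.lift a (S.indexAt p) p : ℂ) (ψ p) := rfl

theorem comp_eq_spinRep_val (a : ι) (ψ : S.SpinorField) (p : M) :
    comp a ψ p = spinRep (S.lift a (S.indexAt p) p : ℂ) (val ψ p) := by
  have h : val ψ p = ψ p := by
    rw [val, comp_eq, S.lift_self _ _ (S.mem_baseSet_at p), Circle.coe_one]
    exact spinRep_one _
  rw [h, comp_eq]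

theorem mdifferentiableAt_comp (ha : p ∈ S.baseSet a) (ψ : S.SpinorField) :
    MDifferentiableAt 𝓘(ℝ, Plane) 𝓘(ℝ, Spinor) (comp a ψ) p :=
  have : MemTrivializationAtlas (S.spinorBundle.localTriv a) := ⟨a, rfl⟩
  ((Bundle.Trivialization.contMDiffAt_section_iff (S.spinorBundle.localTriv a) ha).1
    (ψ.contMDiff p)).mdifferentiableAt (by simp)

/-- The product `⟨ψ, X · φ⟩` may be computed in any trivialization. -/
theorem herm_cliff (ha : p ∈ S.baseSet a) (ψ φ : S.SpinorField)
    (X : TangentSpace 𝓘(ℝ, Plane) p) :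
    herm (val ψ p) (S.cliff p X (val φ p))
      = ∑ k, (h.inner p X (S.frame a k p) : ℂ) * herm (comp a ψ p) ((gam k).mulVec (comp a φ p)) := by
  rw [comp_eq_spinRep_val, comp_eq_spinRep_val]
  have h0 := S.frame_change_zero a (S.indexAt p) p ⟨ha, S.mem_baseSet_at p⟩
  have h1 := S.frame_change_one a (S.indexAt p) p ⟨ha, S.mem_baseSet_at p⟩
  simp only [cliff, Fin.sum_univ_two, h0, h1, map_add, map_smul, smul_eq_mul]
  generalize val ψ p = x, val φ p = y
  generalize h.inner p X (S.frame a 0 p) = s, h.inner p X (S.frame a 1 p) = t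
  -- `spinRep w` is the diagonal matrix with entries `w` and its conjugate, and Clifford
  -- multiplication is off-diagonal. The pairings therefore pick up `w ^ 2` or its conjugate,
  -- matching the rotation of the frame; this is an identity in every complex `w`.
  generalize ((S.lift a (S.indexAt p) p : Circle) : ℂ) = w
  obtain ⟨α, β⟩ := w
  simp only [spinRep_apply, herm, Fin.sum_univ_two, gam_mulVec_zero, gam_mulVec_one,
    gam_mul_gam_mulVec, pow_two]
  simp
  linear_combination (x 0 * (starRingEnd ℂ) (y 1) * (-s * β ^ 2 + 2 * α * β * t
      + Complex.I * β ^ 2 * t)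
    + x 1 * (starRingEnd ℂ) (y 0) * (s * β ^ 2 - 2 * α * β * t + Complex.I * β ^ 2 * t))
    * Complex.I_mul_I

end SpinStructure

end Coframe

/-! ### Exterior derivative and commutator of the currents -/

section Currents

variable {M : Type*} [TopologicalSpace M]

theorem matrixDeriv_const_smul {q : ℕ} (c : OpenPartialHomeomorph M Plane) (k : Fin 2) (z : ℂ)
    (A : M → Matrix (Fin q) (Fin q) ℂ) (p : M) :
    matrixDeriv c k (fun r => z • A r) p = z • matrixDeriv c k A p := by
  ext i m
  simp only [matrixDeriv, Matrix.of_apply, partialDeriv, Matrix.smul_apply]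
  change fderiv ℝ (z • ((fun r => A r i m) ∘ c.symm)) (c p) _ = _
  rw [fderiv_const_smul_field]
  rfl

/-- The derivative part of the curvature scales by `-z` and the commutator by `z ^ 2`, so `-z`
factors out and leaves the expression in `hJ`. -/
theorem curvature_smul_eq_zero {q : ℕ} {c : OpenPartialHomeomorph M Plane}
    {J : Fin 2 → M → Matrix (Fin q) (Fin q) ℂ} {p : M} {z : ℂ}
    (hJ : matrixDeriv c 0 (J 1) p - matrixDeriv c 1 (J 0) p
      - z • (J 0 p * J 1 p - J 1 p * J 0 p) = 0) :
    curvature c (fun k r => -z • J k r) p = 0 := by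
  have h : curvature c (fun k r => -z • J k r) p = -z • (matrixDeriv c 0 (J 1) p
      - matrixDeriv c 1 (J 0) p - z • (J 0 p * J 1 p - J 1 p * J 0 p)) := by
    simp only [curvature, matrixDeriv_const_smul, Matrix.smul_mul, Matrix.mul_smul]
    module
  rw [h, hJ, smul_zero]

variable [ChartedSpace Plane M] [IsManifold 𝓘(ℝ, Plane) ∞ M]

namespace SpinStructure

variable {h : SurfaceMetric M} {ι : Type*} {S : SpinStructure h ι}
  {c : OpenPartialHomeomorph M Plane} {p : M} {a : ι} {q : ℕ}

/-- The preferred trivialization in `val` changes with the point, so differentiating the current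
needs this formula with a fixed index `a`. -/
theorem current_apply (ha : p ∈ S.baseSet a) (ψ : Fin q → S.SpinorField) (k : Fin 2)
    (i m : Fin q) :
    current ψ c k p i m
      = ∑ l, S.coordCoeff a c k l p • hermMulVec (gam l) (comp a (ψ i) p) (comp a (ψ m) p) := by
  rw [current, Matrix.of_apply, herm_cliff ha]
  simp only [Complex.real_smul, coordCoeff, hermMulVec_apply]

theorem partialDeriv_current (hc : c ∈ IsManifold.maximalAtlas 𝓘(ℝ, Plane) ∞ M)
    (hp : p ∈ c.source) (ha : p ∈ S.baseSet a) (ψ : Fin q → S.SpinorField) (j k : Fin 2)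
    (i m : Fin q) :
    partialDeriv c j (fun r => current ψ c k r i m) p
      = ∑ l, (S.coordCoeff a c k l p
          • (hermMulVec (gam l) (mvfderiv 𝓘(ℝ, Plane) (comp a (ψ i)) p (coordField c j p))
              (comp a (ψ m) p)
            + hermMulVec (gam l) (comp a (ψ i) p)
              (mvfderiv 𝓘(ℝ, Plane) (comp a (ψ m)) p (coordField c j p)))
        + mvfderiv 𝓘(ℝ, Plane) (S.coordCoeff a c k l) p (coordField c j p)
          • hermMulVec (gam l) (comp a (ψ i) p) (comp a (ψ m) p)) := by
  have hev : (fun r => current ψ c k r i m) ∘ c.symm =ᶠ[nhds (c p)] fun y =>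
      ∑ l, (S.coordCoeff a c k l ∘ c.symm) y
        • hermMulVec (gam l) ((comp a (ψ i) ∘ c.symm) y) ((comp a (ψ m) ∘ c.symm) y) := by
    have h1 : c.symm ⁻¹' S.baseSet a ∈ nhds (c p) :=
      (c.continuousAt_symm (c.map_source hp)).preimage_mem_nhds
        ((S.isOpen_baseSet a).mem_nhds (by rwa [c.left_inv hp]))
    filter_upwards [h1] with y hy
    exact current_apply hy ψ k i m
  have hd (n : Fin q) := mdifferentiableAt_comp ha (ψ n)
  have hs (l : Fin 2) := S.mdifferentiableAt_coordCoeff hc hp ha k l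
  rw [partialDeriv, hev.fderiv_eq, fderiv_sum_smul_bilinear
    (fun l => differentiableAt_comp_chart_symm hc hp (hs l))
    (differentiableAt_comp_chart_symm hc hp (hd i))
    (differentiableAt_comp_chart_symm hc hp (hd m))]
  refine Finset.sum_congr rfl fun l _ => ?_
  rw [fderiv_comp_chart_symm hc hp (hd i), fderiv_comp_chart_symm hc hp (hd m),
    fderiv_comp_chart_symm hc hp (hs l), Function.comp_apply, Function.comp_apply,
    Function.comp_apply, c.left_inv hp]

theorem cliff_frame (k : Fin 2) (φ : Spinor) :
    S.cliff p (S.frame (S.indexAt p) k p) φ = (gam k).mulVec φ := by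
  have ho := S.orthonormal _ p (S.mem_baseSet_at p)
  fin_cases k <;> simp [cliff, ho]

theorem dirac_eq (ψ : S.SpinorField) (p : M) :
    dirac ψ p = ∑ k, (gam k).mulVec
      (mvfderiv 𝓘(ℝ, Plane) (comp (S.indexAt p) ψ) p (S.frame (S.indexAt p) k p)
        + (S.connForm (S.indexAt p) p (S.frame (S.indexAt p) k p) / 2)
          • (gam 0 * gam 1).mulVec (val ψ p)) := by
  simp only [dirac, cliff_frame]
  rfl

variable (S) in
/-- The Jacobian determinant of the coordinate frame with respect to the orthonormal frame. -/
def coordDet (c : OpenPartialHomeomorph M Plane) (p : M) : ℝ :=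
  S.coordCoeff (S.indexAt p) c 0 0 p * S.coordCoeff (S.indexAt p) c 1 1 p
    - S.coordCoeff (S.indexAt p) c 0 1 p * S.coordCoeff (S.indexAt p) c 1 0 p

/-- The exterior derivative of the Noether current of a Gross-Neveu solution. -/
theorem exteriorDeriv_current {ψ : Fin q → S.SpinorField} {lam κ : ℝ}
    (hψ : IsGrossNeveuSolution lam κ ψ)
    (hc : c ∈ IsManifold.maximalAtlas 𝓘(ℝ, Plane) ∞ M) (hp : p ∈ c.source) (i m : Fin q) :
    (matrixDeriv c 0 (current ψ c 1) p - matrixDeriv c 1 (current ψ c 0) p) i m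
      = S.coordDet c p * (2 * (lam + κ * totalNormSq ψ p : ℝ)
        * herm (val (ψ i) p) ((gam 0 * gam 1).mulVec (val (ψ m) p))) := by
  have ha := S.mem_baseSet_at p
  have hD (n : Fin q) := hψ n p
  simp only [dirac_eq, ← add_smul] at hD
  -- Both equations have the same real factor `lam + κ|ψ|²`, as the algebraic identity requires.
  rw [← herm_exteriorDeriv (hD i) (hD m)]
  have hs (l : Fin 2) := S.deriv_coordCoeff hc hp ha l
  have hs0 := congrArg (fun x : ℝ => (x : ℂ)) (hs 0)
  have hs1 := congrArg (fun x : ℝ => (x : ℂ)) (hs 1)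
  simp only [Matrix.sub_apply, matrixDeriv, Matrix.of_apply, partialDeriv_current hc hp ha,
    Fin.sum_univ_two]
  have he (k : Fin 2) (n : Fin q) :
      mvfderiv 𝓘(ℝ, Plane) (comp (S.indexAt p) (ψ n)) p (coordField c k p)
        = S.coordCoeff (S.indexAt p) c k 0 p • mvfderiv 𝓘(ℝ, Plane) (comp (S.indexAt p) (ψ n)) p
            (S.frame (S.indexAt p) 0 p)
          + S.coordCoeff (S.indexAt p) c k 1 p • mvfderiv 𝓘(ℝ, Plane) (comp (S.indexAt p) (ψ n)) p
            (S.frame (S.indexAt p) 1 p) := by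
    conv_lhs => rw [S.coordField_eq ha k]
    rw [map_add, map_smul, map_smul]
  simp only [he, map_add, map_smul, add_apply, smul_apply, hermMulVec_apply, Complex.real_smul,
    coordDet, val] at *
  push_cast at *
  -- The spinor derivatives already match after antisymmetrization; the derivatives of the coframe
  -- are replaced through Cartan's equation.
  linear_combination
    herm (comp (S.indexAt p) (ψ i) p) ((gam 0).mulVec (comp (S.indexAt p) (ψ m) p)) * hs0
    + herm (comp (S.indexAt p) (ψ i) p) ((gam 1).mulVec (comp (S.indexAt p) (ψ m) p)) * hs1

/-- Summed over `j`, the expression is alternating in the two coordinate directions, so passing to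
the frame costs the determinant. -/
theorem commutator_current (ψ : Fin q → S.SpinorField) (i m : Fin q) :
    (current ψ c 0 p * current ψ c 1 p - current ψ c 1 p * current ψ c 0 p) i m
      = S.coordDet c p * ∑ j, (herm (val (ψ i) p) ((gam 0).mulVec (val (ψ j) p))
            * herm (val (ψ j) p) ((gam 1).mulVec (val (ψ m) p))
          - herm (val (ψ i) p) ((gam 1).mulVec (val (ψ j) p))
            * herm (val (ψ j) p) ((gam 0).mulVec (val (ψ m) p))) := by
  simp only [Matrix.sub_apply, Matrix.mul_apply, current_apply (S.mem_baseSet_at p),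
    ← Finset.sum_sub_distrib, Finset.mul_sum]
  refine Finset.sum_congr rfl fun j _ => ?_
  simp only [Fin.sum_univ_two, Complex.real_smul, hermMulVec_apply, coordDet, val]
  push_cast
  ring

/-- In this model the chirality splitting is the splitting of `ℂ²` into coordinates, with `P₋` the
first and `P₊` the second. -/
theorem volumeElement_eq (φ : Spinor) : S.volumeElement p φ = ![-φ 0, φ 1] := by
  rw [volumeElement, cliff_frame, cliff_frame, Matrix.mulVec_mulVec, gam_mul_gam_mulVec]
  ext k
  fin_cases k <;> simp [← mul_assoc]

theorem projMinus_eq (φ : Spinor) : S.projMinus p φ = ![φ 0, 0] := by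
  ext k
  fin_cases k
  · simp only [projMinus, volumeElement_eq, Pi.smul_apply, Pi.sub_apply, smul_eq_mul]
    simp
    ring
  · simp only [projMinus, volumeElement_eq, Pi.smul_apply, Pi.sub_apply, smul_eq_mul]
    simp

theorem projPlus_eq (φ : Spinor) : S.projPlus p φ = ![0, φ 1] := by
  ext k
  fin_cases k
  · simp only [projPlus, volumeElement_eq, Pi.smul_apply, Pi.add_apply, smul_eq_mul]
    simp
  · simp only [projPlus, volumeElement_eq, Pi.smul_apply, Pi.add_apply, smul_eq_mul]
    simp
    ring

theorem commutator_current_of_majoranaAt {ψ : Fin q → S.SpinorField} {i m : Fin q}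
    (hM : MajoranaAt ψ i m p) :
    (current ψ c 0 p * current ψ c 1 p - current ψ c 1 p * current ψ c 0 p) i m
      = S.coordDet c p * (2 * totalNormSq ψ p
        * herm (val (ψ i) p) ((gam 0 * gam 1).mulVec (val (ψ m) p))) := by
  rw [commutator_current]
  congr 1
  simp only [MajoranaAt, projMinus_eq, projPlus_eq, herm, normSq, Fin.sum_univ_two] at hM
  simp only [herm_gam_commutator, herm_gam_mul_gam, totalNormSq, normSq, Fin.sum_univ_two,
    Finset.sum_add_distrib, ← Finset.mul_sum, Finset.sum_sub_distrib, ← Finset.sum_mul]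
  simp at hM ⊢
  -- With `a, b, u, v` as in the overview, the two sides differ by `2i (a u - b v)`.
  linear_combination (-2 * Complex.I) * hM

/-- The cubic part of the Dirac equation cancels against the commutator. No orthogonality of the
coordinates enters, so this serves both parts of the theorem. -/
theorem curvatureDefect_of_majoranaAt {ψ : Fin q → S.SpinorField} {lam κ : ℝ}
    (hψ : IsGrossNeveuSolution lam κ ψ)
    (hc : c ∈ IsManifold.maximalAtlas 𝓘(ℝ, Plane) ∞ M) (hp : p ∈ c.source) {i m : Fin q}
    (hM : MajoranaAt ψ i m p) :
    (matrixDeriv c 0 (current ψ c 1) p - matrixDeriv c 1 (current ψ c 0) p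
          - (κ : ℂ) • (current ψ c 0 p * current ψ c 1 p
            - current ψ c 1 p * current ψ c 0 p)) i m
      = 2 * lam * (S.coordDet c p
        * herm (val (ψ i) p) ((gam 0 * gam 1).mulVec (val (ψ m) p))) := by
  rw [Matrix.sub_apply, Matrix.smul_apply, exteriorDeriv_current hψ hc hp,
    commutator_current_of_majoranaAt hM]
  push_cast [smul_eq_mul]
  ring

/-- In general `∂ₓ · ∂_y · = -h(∂ₓ, ∂_y) + coordDet e₁ · e₂ ·`; orthogonality removes the scalar
part. -/
theorem cliff_coordField_cliff_coordField
    (h0 : h.inner p (coordField c 0 p) (coordField c 1 p) = 0) (φ : Spinor) :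
    S.cliff p (coordField c 0 p) (S.cliff p (coordField c 1 p) φ)
      = S.coordDet c p • (gam 0 * gam 1).mulVec φ := by
  rw [S.inner_coordField (S.mem_baseSet_at p)] at h0
  have h0 : (_ : ℂ) = _ := congrArg (fun x : ℝ => (x : ℂ)) h0
  push_cast at h0
  change (∑ k, S.coordCoeff (S.indexAt p) c 0 k p • (gam k).mulVec
    (∑ l, S.coordCoeff (S.indexAt p) c 1 l p • (gam l).mulVec φ)) = _
  simp only [Fin.sum_univ_two, gam_mulVec_zero, gam_mulVec_one, gam_mul_gam_mulVec, coordDet]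
  ext k
  fin_cases k
  · simp
    linear_combination (norm := (ring_nf; simp only [Complex.I_sq]; ring)) (-φ 0) * h0
  · simp
    linear_combination (norm := (ring_nf; simp only [Complex.I_sq]; ring)) (-φ 1) * h0

end SpinStructure

end Currents

end GrossNeveu

end

open scoped Manifold ContDiff in
open GrossNeveu SpinStructure in
theorem mainTheorem11 {M : Type*} [TopologicalSpace M] [ChartedSpace Plane M]
    [IsManifold 𝓘(ℝ, Plane) ∞ M] (h : SurfaceMetric M) {ι : Type*} (S : SpinStructure h ι) {q : ℕ}
    (ψ : Fin q → S.SpinorField) (lam κ : ℝ) (hψ : IsGrossNeveuSolution lam κ ψ)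
    (c : OpenPartialHomeomorph M Plane) (hc : c ∈ IsManifold.maximalAtlas 𝓘(ℝ, Plane) ∞ M)
    (p : M) (hp : p ∈ c.source) :
    (∀ i m : Fin q, MajoranaAt ψ i m p →
      h.inner p (coordField c 0 p) (coordField c 1 p) = 0 →
      (matrixDeriv c 0 (current ψ c 1) p - matrixDeriv c 1 (current ψ c 0) p
          - (κ : ℂ) • (current ψ c 0 p * current ψ c 1 p
            - current ψ c 1 p * current ψ c 0 p)) i m
        = 2 * (lam : ℂ) * herm (val (ψ i) p)
            (S.cliff p (coordField c 0 p) (S.cliff p (coordField c 1 p) (val (ψ m) p)))) ∧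
    (lam = 0 → (∀ i m : Fin q, MajoranaAt ψ i m p) →
      matrixDeriv c 0 (current ψ c 1) p - matrixDeriv c 1 (current ψ c 0) p
          - (κ : ℂ) • (current ψ c 0 p * current ψ c 1 p
            - current ψ c 1 p * current ψ c 0 p) = 0 ∧
      curvature c (fun k r => -(κ : ℂ) • current ψ c k r) p = 0) := by
  refine ⟨fun i m hM h0 => ?_, fun hlam hM => ?_⟩
  · rw [curvatureDefect_of_majoranaAt hψ hc hp hM, cliff_coordField_cliff_coordField h0,
      herm_real_smul]
  · have hflat : matrixDeriv c 0 (current ψ c 1) p - matrixDeriv c 1 (current ψ c 0) p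
        - (κ : ℂ) • (current ψ c 0 p * current ψ c 1 p
          - current ψ c 1 p * current ψ c 0 p) = 0 := by
      ext i m
      rw [curvatureDefect_of_majoranaAt hψ hc hp (hM i m), hlam]
      simp
    exact ⟨hflat, curvature_smul_eq_zero hflat⟩
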